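/- Let $\mathcal Q$ be the infinite two-dimensional square grid, i.e. the metric graph embedded in $\mathbb R^2$ with vertex set $\mathbb Z^2$ and with an edge (a unit segment) between any two vertices at distance $1$. A *defected grid* is a connected subgraph $\mathcal G\subset\mathcal Q$ such that a vertex of $\mathcal Q$ fails to belong to $\mathcal G$ if and only if none of the edges of $\mathcal Q$ incident at it belongs to $\mathcal G$, and such that for every vertex $v$ of $\mathcal G$ $$\liminf_{n\to+\infty}\frac{|B_n(v,\mathcal G)|}{|B_n(v,\mathcal Q)|}>0,$$ where $|\cdot|$ is the one-dimensional Hausdorff measure and $B_n(v,\cdot)$ is the open ball with centre $v$ and radius $n$ for the shortest-path distance. Let $L^p(\mathcal G)$ be normed by $\|u\|_{L^p(\mathcal G)}^p=\sum_{e}\int_0^1|u_e|^p\,dx$, the sum being over the edges $e$ of $\mathcal G$, each identified with $[0,1]$, and $u_e$ being the restriction of $u$ to $e$; let $W^{1,1}(\mathcal G)$ be the space of the continuous functions $u:\mathcal G\to\mathbb R$ that have a weak derivative $u'$ on each edge and satisfy $\|u\|_{L^1(\mathcal G)}+\|u'\|_{L^1(\mathcal G)}<\infty$. **Theorem.** Let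 $\mathcal G$ be a defected grid. Then there is a constant $S_{\mathcal G}>0$ (depending only on $\mathcal G$) such that $$\|u\|_{L^2(\mathcal G)}\le S_{\mathcal G}\,\|u'\|_{L^1(\mathcal G)}\qquad\text{for all }u\in W^{1,1}(\mathcal G)$$ if and only if there is a constant $C_{\mathcal G}>0$ (depending only on $\mathcal G$) such that $$\sqrt{A_{\mathcal G}(\Omega)}\le C_{\mathcal G}\,P_{\mathcal G}(\Omega)\qquad\text{for every bounded }\Omega\subset\mathcal G.$$ Here $A_{\mathcal G}(\Omega)=\int_{\mathcal G}\mathbf 1_\Omega(x)\,dx$ is the area (total length) of $\Omega$, and $P_{\mathcal G}(\Omega)=\sum_{x\in\partial\Omega}p(x)\in[0,+\infty]$ is its perimeter, where $\partial\Omega$ is the topological boundary of $\Omega$ in $\mathcal G$ (the points of $\mathcal G$ every neighbourhood of which meets both $\Omega$ and $\mathcal G\setminus\Omega$) and $p(x)$ is the number of the (closed) edges $e$ of $\mathcal G$ such that $x\in e$ and $e\cap(\mathcal G\setminus\Omega)\ne\emptyset$. -/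

import Mathlib

open Set Filter MeasureTheory
open scoped ENNReal NNReal ContDiff

noncomputable section

namespace MetricGrid

/-- The Euclidean plane `ℝ²`, in which the grid is isometrically embedded. -/
abbrev Plane := EuclideanSpace ℝ (Fin 2)

/-- Vertices of the undefected grid: the integer lattice. -/
abbrev Vertex := ℤ × ℤ

/-- A vertex as a point of the plane. -/
def vertexPoint (v : Vertex) : Plane := !₂[(v.1 : ℝ), (v.2 : ℝ)]

/-- Edges of the undefected grid: `horiz i j` joins `(i, j)` to `(i + 1, j)` and
`vert i j` joins `(i, j)` to `(i, j + 1)`. -/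
inductive Edge where
  | horiz (i j : ℤ) : Edge
  | vert (i j : ℤ) : Edge

namespace Edge

/-- The unit speed parametrization of an edge; it is used for `t ∈ [0, 1]`. -/
def point : Edge → ℝ → Plane
  | horiz i j, t => !₂[(i : ℝ) + t, (j : ℝ)]
  | vert i j, t => !₂[(i : ℝ), (j : ℝ) + t]

/-- The endpoint at `t = 0`. -/
def source : Edge → Vertex
  | horiz i j => (i, j)
  | vert i j => (i, j)

/-- The endpoint at `t = 1`. -/
def target : Edge → Vertex
  | horiz i j => (i + 1, j)
  | vert i j => (i, j + 1)

/-- The edge is incident at the vertex `v`. -/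
def Incident (e : Edge) (v : Vertex) : Prop := e.source = v ∨ e.target = v

/-- The closed segment occupied by an edge (endpoints included). -/
def carrier (e : Edge) : Set Plane := e.point '' Icc 0 1

end Edge

/-- A subgraph of the two-dimensional grid. -/
structure Subgrid where
  verts : Set Vertex
  edges : Set Edge
  source_mem : ∀ e ∈ edges, e.source ∈ verts
  target_mem : ∀ e ∈ edges, e.target ∈ verts

/-- The undefected grid `Q`. -/
def fullGrid : Subgrid where
  verts := univ
  edges := univ
  source_mem := fun _ _ => mem_univ _
  target_mem := fun _ _ => mem_univ _

namespace Subgrid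

variable (G : Subgrid)

/-- The set of points of the metric graph `G`, as a subset of the plane. -/
def carrier : Set Plane := vertexPoint '' G.verts ∪ ⋃ e ∈ G.edges, e.carrier

/-- `f : [a, b] → G` parametrizes a path in `G` from `q` to `r`: it is continuous and every point
of the path that is neither a vertex nor one of `q`, `r` has exactly one preimage. -/
structure IsPath (f : ℝ → Plane) (a b : ℝ) (q r : Plane) : Prop where
  le : a ≤ b
  continuousOn : ContinuousOn f (Icc a b)
  mapsTo : MapsTo f (Icc a b) G.carrier
  source_eq : f a = q
  target_eq : f b = r
  unique_preimage : ∀ s ∈ Icc a b, ∀ t ∈ Icc a b, f s = f t →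
    f s ∉ vertexPoint '' G.verts → f s ≠ q → f s ≠ r → s = t

/-- The distance in `G`: the least length (one-dimensional Hausdorff measure) of a path in `G`
connecting `q` and `r`, with value `∞` if there is none. -/
def pathDist (q r : Plane) : ℝ≥0∞ :=
  ⨅ (f : ℝ → Plane) (a : ℝ) (b : ℝ) (_ : G.IsPath f a b q r), μH[1] (f '' Icc a b)

/-- The open ball of `G` with centre `q` and radius `R` for the distance in `G`. -/
def ball (q : Plane) (R : ℝ) : Set Plane :=
  {r | r ∈ G.carrier ∧ G.pathDist q r < ENNReal.ofReal R}

/-- `G` is a defected grid: a connected subgraph of `Q`, a vertex of `Q` being removed exactly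
when all the edges incident at it are, whose balls grow in length, up to a factor, at least as
those of `Q` do. -/
structure IsDefectedGrid : Prop where
  connected : IsConnected G.carrier
  removed_iff : ∀ v : Vertex, v ∉ G.verts ↔ ∀ e : Edge, e.Incident v → e ∉ G.edges
  growth : ∀ v ∈ G.verts,
    0 < liminf (fun n : ℕ => μH[1] (G.ball (vertexPoint v) n) /
      μH[1] (fullGrid.ball (vertexPoint v) n)) atTop

/-- The `L^p(G)` norm, `1 ≤ p < ∞`, of a function on `G` given as a family of functions on
`(0, 1)` indexed by the edges: `‖f‖_p ^ p = ∑_e ∫_0^1 |f_e| ^ p`. -/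
def lpNorm (p : ℝ) (f : Edge → ℝ → ℝ) : ℝ≥0∞ :=
  (∑' e : G.edges, ∫⁻ t in Ioo (0 : ℝ) 1, ‖f e t‖ₑ ^ p) ^ (1 / p)

/-- The family `(u_e)` of restrictions to the edges of a function `u`. -/
def onEdges (u : Plane → ℝ) : Edge → ℝ → ℝ := fun e t => u (e.point t)

end Subgrid

/-- `f` belongs to `W^{1,1}(0, 1)` and `g` is its weak derivative. -/
structure HasWeakDeriv (f g : ℝ → ℝ) : Prop where
  integrableOn : IntegrableOn f (Ioo 0 1)
  integrableOn_deriv : IntegrableOn g (Ioo 0 1)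
  integral_eq : ∀ φ : ℝ → ℝ, ContDiff ℝ ∞ φ → HasCompactSupport φ → tsupport φ ⊆ Ioo 0 1 →
    ∫ t in Ioo (0 : ℝ) 1, f t * deriv φ t = - ∫ t in Ioo (0 : ℝ) 1, g t * φ t

namespace Subgrid

variable (G : Subgrid)

/-- `u ∈ W^{1,1}(G)`, with `u'` as its derivative. Only the values of `u` on `G` and of `u'` on
the edges of `G` matter. -/
structure IsW11 (u : Plane → ℝ) (u' : Edge → ℝ → ℝ) : Prop where
  continuousOn : ContinuousOn u G.carrier
  hasWeakDeriv : ∀ e ∈ G.edges, HasWeakDeriv (onEdges u e) (u' e)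
  lpNorm_lt_top : G.lpNorm 1 (onEdges u) < ⊤
  lpNorm_deriv_lt_top : G.lpNorm 1 u' < ⊤

/-- The area of `Ω ⊆ G`: the integral over `G` of the indicator function of `Ω`. -/
def area (Ω : Set Plane) : ℝ≥0∞ :=
  ∑' e : G.edges, volume {t ∈ Icc (0 : ℝ) 1 | (e : Edge).point t ∈ Ω}

/-- The topological boundary in `G` of `Ω ⊆ G`: the points of `G` all of whose neighbourhoods meet
both `Ω` and `G \ Ω`. -/
def boundary (Ω : Set Plane) : Set Plane :=
  {x ∈ G.carrier | x ∈ closure Ω ∧ x ∈ closure (G.carrier \ Ω)}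

/-- The number `p(x)` of the (closed) edges of `G` that contain `x` and meet `G \ Ω`. -/
def edgeCount (Ω : Set Plane) (x : Plane) : ℕ∞ :=
  {e ∈ G.edges | x ∈ e.carrier ∧ (e.carrier ∩ (G.carrier \ Ω)).Nonempty}.encard

/-- The perimeter of `Ω ⊆ G`: the sum of `p(x)` over the boundary points `x` of `Ω`. -/
def perimeter (Ω : Set Plane) : ℝ≥0∞ :=
  ∑' x : G.boundary Ω, (G.edgeCount Ω x : ℝ≥0∞)

end Subgrid

end MetricGrid

end

/-! Both implications come from the correspondence between functions and their superlevel sets.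

Isoperimetric to Sobolev (`sobolev_of_isoperimetric`): apply the isoperimetric inequality to `Ω_τ =
{τ < |u|}` for each `τ > 0`. This set is bounded, since `|u|` exceeds `τ` only on finitely many
edges. By the layer cake formula `‖u‖₂² = 2 ∫ τ A(Ω_τ) dτ` with `A(Ω_τ)` decreasing in `τ`, hence
`‖u‖₂ ≤ ∫ √A(Ω_τ) dτ` (`lpNorm_two_le`). It remains to bound `∫ P(Ω_τ) dτ` by `‖u'‖₁`
(`IsW11.lintegral_perimeter_le`). The boundary of `Ω_τ` lies in `{|u| = τ}`, so the perimeter is at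
most the number of solutions of `|u_e| = τ`, summed over the edges; on each edge the integral of
this number over `τ` is controlled by the Banach indicatrix inequality. The latter needs `u_e` to be
the primitive of its weak derivative, which is where the du Bois-Reymond lemma enters.

Sobolev to isoperimetric (`isoperimetric_of_sobolev`): if the perimeter is finite, so is the
boundary, because `p ≥ 1` on it. Test the Sobolev inequality with `1_Ω min(1, n d)`, where `d` is
essentially the distance to the boundary. Its slope is at most `n` and vanishes where `n d > 1`; the
remaining part of the grid has length at most `64 / n` per boundary point. Hence `‖u'‖₁ ≤ 64 P(Ω)`
uniformly in `n`, while the sets where the test function is `1` exhaust `Ω` up to a null set. -/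

namespace MetricGrid

open scoped Topology

/-! ### Weak derivatives on the unit interval -/

/-- A smooth function with compact support in `(0, 1)` and vanishing mean has a primitive of the
same kind. -/
theorem exists_primitive_of_integral_eq_zero {k : ℝ → ℝ} (hk : ContDiff ℝ ∞ k)
    (hs : tsupport k ⊆ Ioo 0 1) (hk0 : ∫ x in Ioo (0 : ℝ) 1, k x = 0) :
    ∃ φ : ℝ → ℝ, ContDiff ℝ ∞ φ ∧ HasCompactSupport φ ∧ tsupport φ ⊆ Ioo 0 1 ∧ deriv φ = k := by
  -- Inserting `1 / 2` makes the compact set nonempty even when `k = 0`, so that its infimum and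
  -- supremum belong to it.
  have hcomp : IsCompact (insert (1 / 2) (tsupport k)) := by
    refine IsCompact.insert ?_ _
    exact Metric.isCompact_of_isClosed_isBounded (isClosed_tsupport k)
      ((Metric.isBounded_Ioo 0 1).subset hs)
  have hK : insert (1 / 2) (tsupport k) ⊆ Ioo 0 1 :=
    insert_subset (by norm_num) hs
  have hne : (insert (1 / 2) (tsupport k)).Nonempty := insert_nonempty _ _
  set a := sInf (insert (1 / 2) (tsupport k)) with ha
  set b := sSup (insert (1 / 2) (tsupport k)) with hb
  have ha0 : 0 < a := (hK (hcomp.sInf_mem hne)).1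
  have hb1 : b < 1 := (hK (hcomp.sSup_mem hne)).2
  have hsub : tsupport k ⊆ Icc a b := fun x hx =>
    ⟨csInf_le hcomp.bddBelow (mem_insert_of_mem _ hx), le_csSup hcomp.bddAbove
      (mem_insert_of_mem _ hx)⟩
  have hzero : ∀ x, x ∉ Icc a b → k x = 0 := fun x hx =>
    image_eq_zero_of_notMem_tsupport fun h => hx (hsub h)
  have hcont := hk.continuous
  have hint : ∀ x y, IntervalIntegrable k volume x y := fun x y => hcont.intervalIntegrable x y
  have h01 : ∫ x in (0 : ℝ)..1, k x = 0 := by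
    rw [intervalIntegral.integral_of_le zero_le_one, integral_Ioc_eq_integral_Ioo, hk0]
  have hder : ∀ x, HasDerivAt (fun x => ∫ y in (0 : ℝ)..x, k y) (k x) x := fun x =>
    intervalIntegral.integral_hasDerivAt_right (hint 0 x)
      hcont.stronglyMeasurable.stronglyMeasurableAtFilter hcont.continuousAt
  have hderiv : deriv (fun x => ∫ y in (0 : ℝ)..x, k y) = k := funext fun x => (hder x).deriv
  have hsupp : tsupport (fun x => ∫ y in (0 : ℝ)..x, k y) ⊆ Icc a b := by
    refine closure_minimal (fun x hx => ?_) isClosed_Icc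
    by_contra hxn
    refine hx ?_
    simp only [mem_Icc, not_and_or, not_le] at hxn
    rcases hxn with h | h
    · refine intervalIntegral.integral_zero_ae
        (Eventually.of_forall fun y hy => hzero y fun hy' => ?_)
      rcases mem_uIoc.1 hy with hy | hy <;> linarith [hy.1, hy.2, hy'.1]
    · have h1 : ∫ y in x..1, k y = 0 := by
        refine intervalIntegral.integral_zero_ae
          (Eventually.of_forall fun y hy => hzero y fun hy' => ?_)
        rcases mem_uIoc.1 hy with hy | hy <;> linarith [hy.1, hy.2, hy'.2]
      have := intervalIntegral.integral_add_adjacent_intervals (hint 0 x) (hint x 1)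
      rw [h01, h1, add_zero] at this
      exact this
  refine ⟨fun x => ∫ y in (0 : ℝ)..x, k y, ?_, ?_, ?_, hderiv⟩
  · exact contDiff_infty_iff_deriv.2 ⟨fun x => (hder x).differentiableAt, by rwa [hderiv]⟩
  · exact HasCompactSupport.of_support_subset_isCompact isCompact_Icc
      ((subset_tsupport _).trans hsupp)
  · exact hsupp.trans fun x hx => ⟨ha0.trans_le hx.1, hx.2.trans_lt hb1⟩

/-- The du Bois-Reymond lemma on `(0, 1)`. -/
theorem ae_eq_const_of_integral_mul_deriv_eq_zero {h : ℝ → ℝ} (hh : IntegrableOn h (Ioo 0 1))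
    (h0 : ∀ φ : ℝ → ℝ, ContDiff ℝ ∞ φ → HasCompactSupport φ → tsupport φ ⊆ Ioo 0 1 →
      ∫ t in Ioo (0 : ℝ) 1, h t * deriv φ t = 0) :
    ∃ c : ℝ, ∀ᵐ t, t ∈ Ioo (0 : ℝ) 1 → h t = c := by
  have hmul : ∀ ψ : ℝ → ℝ, Continuous ψ → HasCompactSupport ψ →
      IntegrableOn (fun t => h t * ψ t) (Ioo 0 1) := fun ψ h1 h2 => by
    obtain ⟨C, hC⟩ := h1.bounded_above_of_compact_support h2
    exact hh.mul_bdd h1.aestronglyMeasurable (Eventually.of_forall hC)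
  obtain ⟨ψ₀, hs₀, hc₀, hd₀, hint₀⟩ : ∃ ψ₀ : ℝ → ℝ, tsupport ψ₀ ⊆ Ioo 0 1 ∧
      HasCompactSupport ψ₀ ∧ ContDiff ℝ ∞ ψ₀ ∧ ∫ t in Ioo (0 : ℝ) 1, ψ₀ t = 1 := by
    let B : ContDiffBump (1 / 2 : ℝ) := ⟨1 / 8, 1 / 4, by norm_num, by norm_num⟩
    have hs : tsupport (B.normed volume) ⊆ Ioo 0 1 := by
      rw [B.tsupport_normed_eq, Real.closedBall_eq_Icc]
      intro x hx
      have h1 := hx.1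
      have h2 := hx.2
      simp only [B] at h1 h2
      constructor <;> linarith
    refine ⟨B.normed volume, hs, B.hasCompactSupport_normed, B.contDiff_normed, ?_⟩
    rw [setIntegral_eq_integral_of_forall_compl_eq_zero, B.integral_normed]
    exact fun x hx => image_eq_zero_of_notMem_tsupport fun h => hx (hs h)
  refine ⟨∫ t in Ioo (0 : ℝ) 1, h t * ψ₀ t, ?_⟩
  set c := ∫ t in Ioo (0 : ℝ) 1, h t * ψ₀ t with hc
  have hloc : IntegrableOn (fun t => h t - c) (Ioo 0 1) :=
    hh.sub (integrableOn_const (by simp))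
  have key := isOpen_Ioo.ae_eq_zero_of_integral_contDiff_smul_eq_zero
    (U := Ioo (0 : ℝ) 1) (μ := volume) (f := fun t => h t - c) hloc.locallyIntegrableOn ?_
  · filter_upwards [key] with t ht ht'
    exact sub_eq_zero.1 (ht ht')
  intro ψ hψ hψc hψs
  set m := ∫ t in Ioo (0 : ℝ) 1, ψ t with hm
  have hψi : IntegrableOn ψ (Ioo 0 1) :=
    (hψ.continuous.integrable_of_hasCompactSupport hψc).integrableOn
  have hψi₀ : IntegrableOn ψ₀ (Ioo 0 1) :=
    (hd₀.continuous.integrable_of_hasCompactSupport hc₀).integrableOn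
  -- Subtracting `m ψ₀` from the test function removes its mean, so it becomes the derivative of an
  -- admissible `φ`.
  obtain ⟨φ, h1, h2, h3, h4⟩ := exists_primitive_of_integral_eq_zero
    (k := fun t => ψ t - m * ψ₀ t) (hψ.sub (contDiff_const.mul hd₀)) (by
      refine (tsupport_sub _ _).trans (union_subset hψs ?_)
      exact (tsupport_mul_subset_right).trans hs₀) (by
      rw [integral_sub hψi (hψi₀.const_mul m), integral_const_mul, hint₀, mul_one, sub_self])
  have h5 := h0 φ h1 h2 h3
  rw [h4] at h5
  have e1 : ∫ t in Ioo (0 : ℝ) 1, h t * (ψ t - m * ψ₀ t) =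
      (∫ t in Ioo (0 : ℝ) 1, h t * ψ t) - m * c := by
    rw [hc, ← integral_const_mul, ← integral_sub (hmul ψ hψ.continuous hψc)
      ((hmul ψ₀ hd₀.continuous hc₀).const_mul m)]
    congr 1
    ext t
    ring
  have e2 : ∫ t, ψ t • (h t - c) = ∫ t in Ioo (0 : ℝ) 1, ψ t • (h t - c) := by
    rw [setIntegral_eq_integral_of_forall_compl_eq_zero]
    intro x hx
    rw [image_eq_zero_of_notMem_tsupport fun h => hx (hψs h), zero_smul]
  have e3 : ∫ t in Ioo (0 : ℝ) 1, ψ t • (h t - c) =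
      (∫ t in Ioo (0 : ℝ) 1, h t * ψ t) - m * c := by
    rw [hm, ← integral_mul_const, ← integral_sub (hmul ψ hψ.continuous hψc) (hψi.mul_const c)]
    congr 1
    ext t
    simp only [smul_eq_mul]
    ring
  rw [e2, e3, ← e1, h5]

/-- A continuous function on `[0, 1]` with a weak derivative is the primitive of it. -/
theorem HasWeakDeriv.integral_eq_sub {f g : ℝ → ℝ} (h : HasWeakDeriv f g)
    (hf : ContinuousOn f (Icc 0 1)) {s t : ℝ} (hs : s ∈ Icc (0 : ℝ) 1) (ht : t ∈ Icc (0 : ℝ) 1) :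
    ∫ x in s..t, g x = f t - f s := by
  have hg : IntervalIntegrable g volume 0 1 := by
    rw [intervalIntegrable_iff_integrableOn_Ioo_of_le zero_le_one]
    exact h.integrableOn_deriv
  have hac := hg.absolutelyContinuousOnInterval_intervalIntegral (c := 0) (by simp)
  set p : ℝ → ℝ := fun x => ∫ v in (0 : ℝ)..x, g v with hp
  have hpc : ContinuousOn p (Icc 0 1) := by
    have := hac.continuousOn
    rwa [uIcc_of_le zero_le_one] at this
  have hpi : IntegrableOn p (Ioo 0 1) :=
    (hpc.integrableOn_Icc).mono_set Ioo_subset_Icc_self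
  have hdp : ∀ᵐ x, x ∈ uIoc (0 : ℝ) 1 → deriv p x = g x := by
    have := hg.ae_hasDerivAt_integral
    filter_upwards [this] with x hx hx'
    exact (hx (uIoc_subset_uIcc hx') 0 (by simp)).deriv
  -- The difference of `f` and the primitive `p` of `g` has weak derivative zero; continuity then
  -- extends its a.e. constancy to all of `[0, 1]`.
  obtain ⟨c, hc⟩ := ae_eq_const_of_integral_mul_deriv_eq_zero (h := fun x => f x - p x)
    (h.integrableOn.sub hpi) (fun φ h1 h2 h3 => by
      have hφ0 : ∀ x, x ∉ Ioo (0 : ℝ) 1 → φ x = 0 := fun x hx =>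
        image_eq_zero_of_notMem_tsupport fun h => hx (h3 h)
      have hφac : AbsolutelyContinuousOnInterval φ 0 1 :=
        (h1.of_le (by simp)).contDiffOn.absolutelyContinuousOnInterval
      have hparts := hac.integral_mul_deriv_eq_deriv_mul hφac
      rw [hφ0 1 (by simp), hφ0 0 (by simp), mul_zero, mul_zero, sub_zero, zero_sub,
        intervalIntegral.integral_congr_ae (f := fun x => deriv p x * φ x)
          (g := fun x => g x * φ x)
          (hdp.mono fun x hx hx' => by rw [hx hx'])] at hparts
      rw [intervalIntegral.integral_of_le zero_le_one,
        intervalIntegral.integral_of_le zero_le_one, integral_Ioc_eq_integral_Ioo,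
        integral_Ioc_eq_integral_Ioo, ← h.integral_eq φ h1 h2 h3] at hparts
      obtain ⟨C, hC⟩ := (h1.continuous_deriv (by simp)).bounded_above_of_compact_support h2.deriv
      have hm := (h1.continuous_deriv (by simp)).aestronglyMeasurable
        (μ := volume.restrict (Ioo (0 : ℝ) 1))
      simp_rw [sub_mul]
      rw [integral_sub (h.integrableOn.mul_bdd hm (Eventually.of_forall hC))
        (hpi.mul_bdd hm (Eventually.of_forall hC)), hparts, sub_self])
  have hae : (fun x => f x - p x) =ᵐ[volume.restrict (Ioo 0 1)] fun _ => c :=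
    (ae_restrict_iff' measurableSet_Ioo).2 hc
  have heq : EqOn (fun x => f x - p x) (fun _ => c) (Ioo 0 1) :=
    Measure.eqOn_open_of_ae_eq hae isOpen_Ioo ((hf.sub hpc).mono Ioo_subset_Icc_self)
      continuousOn_const
  have heq' : EqOn (fun x => f x - p x) (fun _ => c) (Icc 0 1) := by
    refine heq.of_subset_closure (hf.sub hpc) continuousOn_const Ioo_subset_Icc_self ?_
    rw [closure_Ioo (by norm_num)]
  have hst := (heq' ht).trans (heq' hs).symm
  have hsub : ∀ {x y : ℝ}, x ∈ Icc (0 : ℝ) 1 → y ∈ Icc (0 : ℝ) 1 →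
      IntervalIntegrable g volume x y := fun {x y} hx hy => hg.mono_set (by
    rw [uIcc_of_le (zero_le_one' ℝ)]
    exact uIcc_subset_Icc hx hy)
  have h0 : (0 : ℝ) ∈ Icc (0 : ℝ) 1 := by simp
  have := intervalIntegral.integral_interval_sub_left (hsub h0 ht) (hsub h0 hs)
  simp only [hp] at hst
  linarith

theorem HasWeakDeriv.edist_le_lintegral {f g : ℝ → ℝ} (h : HasWeakDeriv f g)
    (hf : ContinuousOn f (Icc 0 1)) {s t : ℝ} (hs : s ∈ Icc (0 : ℝ) 1) (ht : t ∈ Icc (0 : ℝ) 1)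
    (hst : s ≤ t) : edist (f s) (f t) ≤ ∫⁻ x in Icc s t, ‖g x‖ₑ := by
  rw [edist_comm, edist_eq_enorm_sub, ← h.integral_eq_sub hf hs ht,
    intervalIntegral.integral_of_le hst]
  exact (enorm_integral_le_lintegral_enorm _).trans
    (lintegral_mono_set Ioc_subset_Icc_self)

/-! ### The Banach indicatrix inequality -/

/-- The `k`-th of the pieces of length `1 / n` of the unit interval. -/
def unitPiece (n k : ℕ) : Set ℝ := {x ∈ Icc (0 : ℝ) 1 | ⌊(n : ℝ) * x⌋₊ = k}

theorem ordConnected_unitPiece (n k : ℕ) : (unitPiece n k).OrdConnected := by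
  refine ⟨fun x hx y hy z hz => ⟨⟨hx.1.1.trans hz.1, hz.2.trans hy.1.2⟩, le_antisymm ?_ ?_⟩⟩
  · rw [← hy.2]
    exact Nat.floor_mono (by gcongr; exact hz.2)
  · rw [← hx.2]
    exact Nat.floor_mono (by gcongr; exact hz.1)

/-- The number of the pieces of length `1 / n` of the unit interval on which `f` takes the
value `y`. -/
noncomputable def pieceCount (f : ℝ → ℝ) (n : ℕ) (y : ℝ) : ℝ≥0∞ :=
  ∑ k ∈ Finset.range (n + 1), (f '' unitPiece n k).indicator 1 y

/-- A measurable majorant of the number of the solutions in `[0, 1]` of the equation `f x = y`. -/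
noncomputable def solutionCount (f : ℝ → ℝ) (y : ℝ) : ℝ≥0∞ :=
  liminf (fun n => pieceCount f n y) atTop

theorem measurable_pieceCount {f : ℝ → ℝ} (hf : ContinuousOn f (Icc 0 1)) (n : ℕ) :
    Measurable (pieceCount f n) := by
  refine Finset.measurable_fun_sum _ fun k _ => measurable_one.indicator ?_
  exact (((ordConnected_unitPiece n k).isPreconnected.image f
    (hf.mono (sep_subset _ _))).ordConnected).measurableSet

theorem measurable_solutionCount {f : ℝ → ℝ} (hf : ContinuousOn f (Icc 0 1)) :
    Measurable (solutionCount f) :=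
  Measurable.liminf fun n => measurable_pieceCount hf n

/-- The image of a piece has length at most the oscillation of `f` on it, hence at most the integral
of `|g|` there; the pieces are disjoint. -/
theorem lintegral_pieceCount_le {f g : ℝ → ℝ} (hf : ContinuousOn f (Icc 0 1))
    (hfg : ∀ s ∈ Icc (0 : ℝ) 1, ∀ t ∈ Icc (0 : ℝ) 1, s ≤ t →
      edist (f s) (f t) ≤ ∫⁻ x in Icc s t, ‖g x‖ₑ) (n : ℕ) :
    ∫⁻ y, pieceCount f n y ≤ ∫⁻ x in Icc 0 1, ‖g x‖ₑ := by
  have hmeas : ∀ k, MeasurableSet (f '' unitPiece n k) := fun k =>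
    (((ordConnected_unitPiece n k).isPreconnected.image f
      (hf.mono (sep_subset _ _))).ordConnected).measurableSet
  have hpiece : ∀ k, volume (f '' unitPiece n k) ≤ ∫⁻ x in unitPiece n k, ‖g x‖ₑ := fun k => by
    refine (Real.volume_le_diam _).trans (Metric.ediam_le ?_)
    have key : ∀ s ∈ unitPiece n k, ∀ t ∈ unitPiece n k, s ≤ t →
        edist (f s) (f t) ≤ ∫⁻ x in unitPiece n k, ‖g x‖ₑ := fun s hs t ht hst =>
      (hfg s hs.1 t ht.1 hst).trans
        (lintegral_mono_set ((ordConnected_unitPiece n k).out hs ht))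
    rintro _ ⟨s, hs, rfl⟩ _ ⟨t, ht, rfl⟩
    rcases le_total s t with h | h
    · exact key s hs t ht h
    · rw [edist_comm]
      exact key t ht s hs h
  calc ∫⁻ y, pieceCount f n y
      = ∑ k ∈ Finset.range (n + 1), volume (f '' unitPiece n k) := by
        unfold pieceCount
        rw [lintegral_finsetSum _ fun k _ => measurable_one.indicator (hmeas k)]
        exact Finset.sum_congr rfl fun k _ => lintegral_indicator_one (hmeas k)
    _ ≤ ∑ k ∈ Finset.range (n + 1), ∫⁻ x in unitPiece n k, ‖g x‖ₑ :=
        Finset.sum_le_sum fun k _ => hpiece k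
    _ = ∫⁻ x in ⋃ k ∈ Finset.range (n + 1), unitPiece n k, ‖g x‖ₑ := by
        refine (lintegral_biUnion_finset ?_ (fun k _ =>
          (ordConnected_unitPiece n k).measurableSet) _).symm
        exact fun i _ j _ hij => disjoint_left.2 fun x hx hx' => hij (hx.2.symm.trans hx'.2)
    _ ≤ ∫⁻ x in Icc 0 1, ‖g x‖ₑ :=
        lintegral_mono_set (iUnion₂_subset fun k _ => sep_subset _ _)

/-- The Banach indicatrix inequality. -/
theorem lintegral_solutionCount_le {f g : ℝ → ℝ} (hf : ContinuousOn f (Icc 0 1))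
    (hfg : ∀ s ∈ Icc (0 : ℝ) 1, ∀ t ∈ Icc (0 : ℝ) 1, s ≤ t →
      edist (f s) (f t) ≤ ∫⁻ x in Icc s t, ‖g x‖ₑ) :
    ∫⁻ y, solutionCount f y ≤ ∫⁻ x in Icc 0 1, ‖g x‖ₑ :=
  (lintegral_liminf_le fun n => measurable_pieceCount hf n).trans
    (liminf_le_of_frequently_le' (Frequently.of_forall fun n => lintegral_pieceCount_le hf hfg n))

/-- Finitely many solutions lie in distinct pieces once `1 / n` is below their mutual distances, so
every large `n` counts them all. An infinite solution set contains finite subsets of any size. -/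
theorem encard_le_solutionCount (f : ℝ → ℝ) (y : ℝ) :
    (({x ∈ Icc (0 : ℝ) 1 | f x = y}.encard : ℕ∞) : ℝ≥0∞) ≤ solutionCount f y := by
  have key : ∀ F : Finset ℝ, (F : Set ℝ) ⊆ {x ∈ Icc (0 : ℝ) 1 | f x = y} →
      (F.card : ℝ≥0∞) ≤ solutionCount f y := by
    intro F hF
    refine le_liminf_of_le (by isBoundedDefault) ?_
    have hinj : ∀ᶠ n : ℕ in atTop, InjOn (fun x : ℝ => ⌊(n : ℝ) * x⌋₊) (F : Set ℝ) := by
      have : ∀ x ∈ F, ∀ x' ∈ F, ∀ᶠ n : ℕ in atTop,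
          ⌊(n : ℝ) * x⌋₊ = ⌊(n : ℝ) * x'⌋₊ → x = x' := by
        intro x hx x' hx'
        by_cases hxx : x = x'
        · exact Eventually.of_forall fun _ _ => hxx
        have hpos : 0 < |x - x'| := abs_pos.2 (sub_ne_zero.2 hxx)
        obtain ⟨N, hN⟩ := exists_nat_gt (1 / |x - x'|)
        filter_upwards [eventually_ge_atTop N] with n hn heq
        exfalso
        have hn' : 1 < n * |x - x'| := by
          rw [div_lt_iff₀ hpos] at hN
          refine hN.trans_le ?_
          gcongr
        have h0 : 0 ≤ (n : ℝ) * x := mul_nonneg n.cast_nonneg (hF hx).1.1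
        have h0' : 0 ≤ (n : ℝ) * x' := mul_nonneg n.cast_nonneg (hF hx').1.1
        have h1 := Nat.floor_le h0
        have h2 := Nat.lt_floor_add_one ((n : ℝ) * x)
        have h1' := Nat.floor_le h0'
        have h2' := Nat.lt_floor_add_one ((n : ℝ) * x')
        rw [heq] at h1 h2
        have : n * |x - x'| = |n * x - n * x'| := by
          rw [← mul_sub, abs_mul, Nat.abs_cast]
        rw [this] at hn'
        have : |n * x - n * x'| < 1 := abs_lt.2 ⟨by linarith, by linarith⟩
        linarith
      have h := (Finset.eventually_all F).2 fun x hx => (Finset.eventually_all F).2 (this x hx)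
      exact h.mono fun n hn x hx x' hx' => hn x hx x' hx'
    filter_upwards [hinj] with n hn
    -- The index `n` itself occurs, for `x = 1`; hence `n + 1` pieces.
    have hsub : F.image (fun x : ℝ => ⌊(n : ℝ) * x⌋₊) ⊆ Finset.range (n + 1) := by
      intro k hk
      obtain ⟨x, hx, rfl⟩ := Finset.mem_image.1 hk
      rw [Finset.mem_range, Nat.lt_succ_iff]
      refine (Nat.floor_mono (mul_le_of_le_one_right n.cast_nonneg (hF hx).1.2)).trans ?_
      simp
    calc (F.card : ℝ≥0∞) = ((F.image (fun x : ℝ => ⌊(n : ℝ) * x⌋₊)).card : ℝ≥0∞) := by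
          rw [Finset.card_image_of_injOn hn]
      _ = ∑ k ∈ F.image (fun x : ℝ => ⌊(n : ℝ) * x⌋₊),
            (f '' unitPiece n k).indicator (1 : ℝ → ℝ≥0∞) y := by
          rw [Finset.cast_card]
          refine Finset.sum_congr rfl fun k hk => ?_
          obtain ⟨x, hx, rfl⟩ := Finset.mem_image.1 hk
          have hy : y ∈ f '' unitPiece n ⌊(n : ℝ) * x⌋₊ := ⟨x, ⟨(hF hx).1, rfl⟩, (hF hx).2⟩
          rw [indicator_of_mem hy, Pi.one_apply]
      _ ≤ pieceCount f n y := Finset.sum_le_sum_of_subset hsub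
  by_cases hfin : {x ∈ Icc (0 : ℝ) 1 | f x = y}.Finite
  · rw [hfin.encard_eq_coe_toFinset_card]
    simpa using key hfin.toFinset (by simp)
  · rw [(show {x ∈ Icc (0 : ℝ) 1 | f x = y}.Infinite from hfin).encard_eq, ENat.toENNReal_top,
      top_le_iff]
    refine ENNReal.eq_top_of_forall_nnreal_le fun r => ?_
    obtain ⟨n, hn⟩ := exists_nat_ge r
    obtain ⟨F, hF, hcard⟩ := (show {x ∈ Icc (0 : ℝ) 1 | f x = y}.Infinite from
      hfin).exists_subset_card_eq n
    refine le_trans ?_ (key F hF)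
    rw [hcard]
    exact_mod_cast hn

/-! ### An integral inequality for decreasing functions -/

/-- A weighted layer cake estimate: `2 ∫ t b(t)² ≤ (∫ b)²` for `b` decreasing. -/
theorem lintegral_mul_sq_le_sq_lintegral {b : ℝ → ℝ≥0∞} (hb : Antitone b) :
    2 * ∫⁻ t in Ioi (0 : ℝ), b t ^ 2 * ENNReal.ofReal t ≤ (∫⁻ t in Ioi (0 : ℝ), b t) ^ 2 := by
  have hbm : Measurable b := hb.measurable
  set μ := volume.restrict (Ioi (0 : ℝ)) with hμ
  -- `K` is `b s * b t` on the triangle `s < t`. Monotonicity gives `t b(t)² ≤ ∫ K s t ds`, and the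
  -- two copies of the triangle obtained by swapping `s` and `t` are disjoint in the quadrant.
  let K : ℝ → ℝ → ℝ≥0∞ := fun s t => (Iio t).indicator (fun s => b s * b t) s
  have hKm : Measurable (Function.uncurry K) := by
    have : Function.uncurry K =
        {p : ℝ × ℝ | p.1 < p.2}.indicator (fun p => b p.1 * b p.2) := by
      ext ⟨s, t⟩
      simp [K, indicator, Function.uncurry]
    rw [this]
    exact Measurable.indicator (by fun_prop) (measurableSet_lt measurable_fst measurable_snd)
  have h1 : ∀ t ∈ Ioi (0 : ℝ), b t ^ 2 * ENNReal.ofReal t ≤ ∫⁻ s, K s t ∂μ := fun t ht => by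
    calc b t ^ 2 * ENNReal.ofReal t = ∫⁻ s in Ioo 0 t, b t * b t := by
          rw [setLIntegral_const, Real.volume_Ioo, sub_zero, sq]
      _ ≤ ∫⁻ s in Ioo 0 t, b s * b t := by
          refine setLIntegral_mono (by fun_prop) fun s hs => ?_
          gcongr
          exact hb hs.2.le
      _ = ∫⁻ s, K s t ∂μ := by
          simp only [K]
          rw [lintegral_indicator measurableSet_Iio, hμ, Measure.restrict_restrict measurableSet_Iio,
            inter_comm, Ioi_inter_Iio]
  have h2 : ∫⁻ t in Ioi (0 : ℝ), b t ^ 2 * ENNReal.ofReal t ≤ ∫⁻ t, ∫⁻ s, K s t ∂μ ∂μ :=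
    setLIntegral_mono' measurableSet_Ioi h1
  have h3 : ∫⁻ t, ∫⁻ s, K s t ∂μ ∂μ = ∫⁻ t, ∫⁻ s, K t s ∂μ ∂μ :=
    lintegral_lintegral_swap (f := fun t s => K s t) (hKm.comp measurable_swap).aemeasurable
  calc 2 * ∫⁻ t in Ioi (0 : ℝ), b t ^ 2 * ENNReal.ofReal t
      ≤ (∫⁻ t, ∫⁻ s, K s t ∂μ ∂μ) + ∫⁻ t, ∫⁻ s, K t s ∂μ ∂μ := by
        rw [two_mul]
        exact add_le_add h2 (h2.trans h3.le)
    _ = ∫⁻ t, ∫⁻ s, (K s t + K t s) ∂μ ∂μ := by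
        rw [← lintegral_add_left]
        · congr 1
          ext t
          rw [lintegral_add_left]
          exact hKm.comp (measurable_id.prodMk measurable_const)
        · exact (hKm.comp measurable_swap).lintegral_prod_right'
    _ ≤ ∫⁻ t, ∫⁻ s, b s * b t ∂μ ∂μ := by
        refine lintegral_mono fun t => lintegral_mono fun s => ?_
        simp only [K, indicator, mem_Iio]
        split_ifs with hs ht ht
        · exact absurd hs ht.not_gt
        · simp
        · simp [mul_comm]
        · simp
    _ = (∫⁻ t in Ioi (0 : ℝ), b t) ^ 2 := by
        simp_rw [lintegral_mul_const _ hbm]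
        rw [lintegral_const_mul _ hbm, sq]

/-! ### Parametrized edges -/

namespace Edge

theorem isometry_point (e : Edge) : Isometry e.point := by
  refine Isometry.of_dist_eq fun s t => ?_
  cases e <;> simp [point, EuclideanSpace.dist_eq, Real.dist_eq, Real.sqrt_sq_eq_abs]

theorem continuous_point (e : Edge) : Continuous e.point := e.isometry_point.continuous

theorem isCompact_carrier (e : Edge) : IsCompact e.carrier :=
  isCompact_Icc.image e.continuous_point

theorem point_zero (e : Edge) : e.point 0 = vertexPoint e.source := by
  cases e <;> simp [point, vertexPoint, source]

theorem point_one (e : Edge) : e.point 1 = vertexPoint e.target := by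
  cases e <;> simp [point, vertexPoint, target]

instance : Countable Edge := by
  refine Function.Injective.countable (β := Bool × ℤ × ℤ)
    (f := fun e => match e with | horiz i j => (true, i, j) | vert i j => (false, i, j)) ?_
  rintro (⟨i, j⟩ | ⟨i, j⟩) (⟨k, l⟩ | ⟨k, l⟩) h <;> simp_all

end Edge

/-! ### From the isoperimetric to the Sobolev inequality -/

namespace Subgrid

variable {G : Subgrid}

theorem point_mem_carrier {e : Edge} (he : e ∈ G.edges) {t : ℝ} (ht : t ∈ Icc (0 : ℝ) 1) :
    e.point t ∈ G.carrier :=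
  Or.inr (mem_biUnion he (mem_image_of_mem _ ht))

/-- If no vertex is isolated, every point belongs to an edge. -/
theorem exists_edge_of_mem_carrier
    (hG : ∀ v : Vertex, v ∉ G.verts ↔ ∀ e : Edge, e.Incident v → e ∉ G.edges)
    {x : Plane} (hx : x ∈ G.carrier) : ∃ e ∈ G.edges, x ∈ e.carrier := by
  rcases hx with ⟨v, hv, rfl⟩ | hx
  · have := (hG v).not.1 (not_not.2 hv)
    push Not at this
    obtain ⟨e, rfl | rfl, he⟩ := this
    · exact ⟨e, he, 0, by simp, e.point_zero⟩
    · exact ⟨e, he, 1, by simp, e.point_one⟩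
  · simpa using hx

theorem continuousOn_onEdges {u : Plane → ℝ} (hu : ContinuousOn u G.carrier) {e : Edge}
    (he : e ∈ G.edges) : ContinuousOn (onEdges u e) (Icc 0 1) :=
  hu.comp e.continuous_point.continuousOn fun _ ht => point_mem_carrier he ht

theorem eq_of_mem_boundary_superlevel {v : Plane → ℝ} (hv : ContinuousOn v G.carrier) {τ : ℝ}
    {x : Plane} (hx : x ∈ G.boundary {x ∈ G.carrier | τ < v x}) : v x = τ := by
  obtain ⟨hxG, h1, h2⟩ := hx
  apply le_antisymm
  · exact ((hv x hxG).mono sdiff_subset).closure_le h2 continuousWithinAt_const fun y hy =>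
      not_lt.1 fun h => hy.2 ⟨hy.1, h⟩
  · exact continuousWithinAt_const.closure_le h1 ((hv x hxG).mono (sep_subset _ _)) fun y hy => hy.2.le

/-- Both sides count incidences of points with edges, so the sums over points and edges can be
exchanged; a vertex is counted once per edge through it. -/
theorem perimeter_superlevel_le {v : Plane → ℝ} (hv : ContinuousOn v G.carrier) (τ : ℝ) :
    G.perimeter {x ∈ G.carrier | τ < v x} ≤
      ∑' e : G.edges, (({t ∈ Icc (0 : ℝ) 1 | onEdges v e t = τ}.encard : ℕ∞) : ℝ≥0∞) := by
  set Ω := {x ∈ G.carrier | τ < v x} with hΩ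
  have h1 : ∀ x : Plane, (G.edgeCount Ω x : ℝ≥0∞) ≤
      ∑' e : G.edges, (e : Edge).carrier.indicator 1 x := by
    intro x
    calc (G.edgeCount Ω x : ℝ≥0∞) ≤ (({e ∈ G.edges | x ∈ e.carrier}.encard : ℕ∞) : ℝ≥0∞) := by
          refine ENat.toENNReal_mono (encard_le_encard fun e he => ⟨he.1, he.2.1⟩)
      _ = ∑' e : Edge, {e ∈ G.edges | x ∈ e.carrier}.indicator 1 e := by
          rw [← ENNReal.tsum_set_one, tsum_subtype _ (fun _ => (1 : ℝ≥0∞))]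
          rfl
      _ = ∑' e : G.edges, (e : Edge).carrier.indicator 1 x := by
          rw [tsum_subtype G.edges fun e => e.carrier.indicator (1 : Plane → ℝ≥0∞) x]
          congr 1
          ext e
          by_cases he : e ∈ G.edges <;> by_cases hx : x ∈ e.carrier <;> simp [he, hx]
  calc G.perimeter Ω
      ≤ ∑' x : G.boundary Ω, ∑' e : G.edges, (e : Edge).carrier.indicator 1 (x : Plane) :=
        ENNReal.tsum_le_tsum fun x => h1 x
    _ = ∑' e : G.edges, ∑' x : G.boundary Ω, (e : Edge).carrier.indicator 1 (x : Plane) :=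
        ENNReal.tsum_comm
    _ ≤ _ := by
        refine ENNReal.tsum_le_tsum fun e => ?_
        calc ∑' x : G.boundary Ω, (e : Edge).carrier.indicator (1 : Plane → ℝ≥0∞) (x : Plane)
            = (((G.boundary Ω ∩ (e : Edge).carrier).encard : ℕ∞) : ℝ≥0∞) := by
              rw [← ENNReal.tsum_set_one,
                tsum_subtype (G.boundary Ω) ((e : Edge).carrier.indicator (1 : Plane → ℝ≥0∞)),
                tsum_subtype _ (fun _ => (1 : ℝ≥0∞)), indicator_indicator]
              rfl
          _ ≤ ((((e : Edge).point '' {t ∈ Icc (0 : ℝ) 1 | onEdges v e t = τ}).encard : ℕ∞) :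
              ℝ≥0∞) := by
              refine ENat.toENNReal_mono (encard_le_encard ?_)
              rintro x ⟨hx, t, ht, rfl⟩
              exact ⟨t, ⟨ht, eq_of_mem_boundary_superlevel hv hx⟩, rfl⟩
          _ ≤ _ := ENat.toENNReal_mono (encard_image_le _ _)

theorem IsW11.edist_le {u : Plane → ℝ} {u' : Edge → ℝ → ℝ} (hu : G.IsW11 u u') {e : Edge}
    (he : e ∈ G.edges) : ∀ s ∈ Icc (0 : ℝ) 1, ∀ t ∈ Icc (0 : ℝ) 1, s ≤ t →
      edist (onEdges u e s) (onEdges u e t) ≤ ∫⁻ x in Icc s t, ‖u' e x‖ₑ :=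
  fun _ hs _ ht hst => (hu.hasWeakDeriv e he).edist_le_lintegral
    (continuousOn_onEdges hu.continuousOn he) hs ht hst

/-- Average `|u(t)| ≤ |u(s)| + ∫ |u'|` over `s` in the edge, which has length one. -/
theorem IsW11.enorm_le {u : Plane → ℝ} {u' : Edge → ℝ → ℝ} (hu : G.IsW11 u u') {e : Edge}
    (he : e ∈ G.edges) {t : ℝ} (ht : t ∈ Icc (0 : ℝ) 1) :
    ‖onEdges u e t‖ₑ ≤ (∫⁻ x in Ioo (0 : ℝ) 1, ‖onEdges u e x‖ₑ) +
      ∫⁻ x in Ioo (0 : ℝ) 1, ‖u' e x‖ₑ := by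
  have key : ∀ s ∈ Icc (0 : ℝ) 1, edist (onEdges u e t) (onEdges u e s) ≤
      ∫⁻ x in Ioo (0 : ℝ) 1, ‖u' e x‖ₑ := by
    intro s hs
    rw [setLIntegral_congr (Ioo_ae_eq_Icc (α := ℝ) (μ := volume))]
    rcases le_total s t with h | h
    · rw [edist_comm]
      exact (hu.edist_le he s hs t ht h).trans (lintegral_mono_set (Icc_subset_Icc hs.1 ht.2))
    · exact (hu.edist_le he t ht s hs h).trans (lintegral_mono_set (Icc_subset_Icc ht.1 hs.2))
  calc ‖onEdges u e t‖ₑ = ∫⁻ _ in Ioo (0 : ℝ) 1, ‖onEdges u e t‖ₑ := by simp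
    _ ≤ ∫⁻ s in Ioo (0 : ℝ) 1, (‖onEdges u e s‖ₑ + ∫⁻ x in Ioo (0 : ℝ) 1, ‖u' e x‖ₑ) := by
        refine setLIntegral_mono' measurableSet_Ioo fun s hs => ?_
        have h := edist_triangle (onEdges u e t) (onEdges u e s) 0
        rw [edist_zero_right, edist_zero_right, add_comm] at h
        exact h.trans (add_le_add_right (key s (Ioo_subset_Icc_self hs)) _)
    _ = _ := by
        rw [lintegral_add_right _ measurable_const]
        simp

theorem lpNorm_one (f : Edge → ℝ → ℝ) :
    G.lpNorm 1 f = ∑' e : G.edges, ∫⁻ t in Ioo (0 : ℝ) 1, ‖f e t‖ₑ := by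
  simp [lpNorm]

theorem isBounded_of_finite {Ω : Set Plane} {F : Set Edge} (hF : F.Finite)
    (h : Ω ⊆ ⋃ e ∈ F, e.carrier) : Bornology.IsBounded Ω :=
  ((Bornology.isBounded_biUnion hF).2 fun e _ => e.isCompact_carrier.isBounded).subset h

/-- By `IsW11.enorm_le`, an edge meeting the set carries at least `τ` of the finite `W^{1,1}` norm,
so there are finitely many such edges. -/
theorem IsW11.isBounded_superlevel
    (hG : ∀ v : Vertex, v ∉ G.verts ↔ ∀ e : Edge, e.Incident v → e ∉ G.edges)
    {u : Plane → ℝ} {u' : Edge → ℝ → ℝ} (hu : G.IsW11 u u') {τ : ℝ} (hτ : 0 < τ) :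
    Bornology.IsBounded {x ∈ G.carrier | τ < |u x|} := by
  have hsum : ∑' e : G.edges, ((∫⁻ x in Ioo (0 : ℝ) 1, ‖onEdges u e x‖ₑ) +
      ∫⁻ x in Ioo (0 : ℝ) 1, ‖u' e x‖ₑ) ≠ ⊤ := by
    rw [ENNReal.tsum_add, ← lpNorm_one, ← lpNorm_one]
    exact ENNReal.add_ne_top.2 ⟨hu.lpNorm_lt_top.ne, hu.lpNorm_deriv_lt_top.ne⟩
  have hfin := ENNReal.finite_const_le_of_tsum_ne_top hsum
    (ε := ENNReal.ofReal τ) (by simpa using hτ)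
  refine isBounded_of_finite (hfin.image Subtype.val) fun x hx => ?_
  obtain ⟨e, he, t, ht, rfl⟩ := exists_edge_of_mem_carrier hG hx.1
  refine mem_biUnion (x := e) ⟨⟨e, he⟩, ?_, rfl⟩ (mem_image_of_mem _ ht)
  refine le_trans ?_ (hu.enorm_le he ht)
  rw [← ofReal_norm]
  exact ENNReal.ofReal_le_ofReal hx.2.le

/-- The `L²` norm is controlled by the square roots of the areas of the superlevel sets. -/
theorem lpNorm_two_le {u : Plane → ℝ} (hu : ContinuousOn u G.carrier) :
    G.lpNorm 2 (onEdges u) ≤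
      ∫⁻ τ in Ioi (0 : ℝ), G.area {x ∈ G.carrier | τ < |u x|} ^ (1 / 2 : ℝ) := by
  set a : G.edges → ℝ → ℝ≥0∞ := fun e τ =>
    volume.restrict (Ioo 0 1) {t | τ < |onEdges u e t|} with ha
  have hanti : ∀ e, Antitone (a e) := fun e s t hst =>
    measure_mono fun x hx => hst.trans_lt hx
  have hA : Antitone fun τ => ∑' e, a e τ := fun s t hst =>
    ENNReal.tsum_le_tsum fun e => hanti e hst
  set b : ℝ → ℝ≥0∞ := fun τ => (∑' e, a e τ) ^ (1 / 2 : ℝ) with hb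
  have hbanti : Antitone b := fun s t hst => ENNReal.rpow_le_rpow (hA hst) (by norm_num)
  -- With `b` the square root of the area, the layer cake integrand `τ A(τ)` becomes `τ b(τ)²`.
  have hb2 : ∀ τ, b τ ^ 2 = ∑' e, a e τ := fun τ => by
    rw [hb, ← ENNReal.rpow_natCast, ← ENNReal.rpow_mul]
    norm_num
  have hedge : ∀ e : G.edges, ∫⁻ t in Ioo (0 : ℝ) 1, ‖onEdges u e t‖ₑ ^ (2 : ℝ) =
      2 * ∫⁻ τ in Ioi (0 : ℝ), a e τ * ENNReal.ofReal τ := by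
    intro e
    have hm : AEMeasurable (fun t => |onEdges u e t|) (volume.restrict (Ioo 0 1)) :=
      ((continuousOn_onEdges hu e.2).mono Ioo_subset_Icc_self).abs.aemeasurable measurableSet_Ioo
    have := lintegral_rpow_eq_lintegral_meas_lt_mul (volume.restrict (Ioo (0 : ℝ) 1))
      (Eventually.of_forall fun t => abs_nonneg (onEdges u e t)) hm (p := 2) two_pos
    rw [ENNReal.ofReal_ofNat] at this
    norm_num only [Real.rpow_one] at this
    refine Eq.trans ?_ this
    congr 1
    ext t
    rw [← ofReal_norm, ENNReal.ofReal_rpow_of_nonneg (norm_nonneg _) (by norm_num),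
      Real.norm_eq_abs]
  have hle : ∀ τ, b τ ≤ G.area {x ∈ G.carrier | τ < |u x|} ^ (1 / 2 : ℝ) := by
    intro τ
    refine ENNReal.rpow_le_rpow (ENNReal.tsum_le_tsum fun e => ?_) (by norm_num)
    rw [ha]
    simp only
    rw [Measure.restrict_apply' measurableSet_Ioo]
    refine measure_mono fun t ht => ⟨Ioo_subset_Icc_self ht.2, ?_, ht.1⟩
    exact point_mem_carrier e.2 (Ioo_subset_Icc_self ht.2)
  calc G.lpNorm 2 (onEdges u)
      = (2 * ∫⁻ τ in Ioi (0 : ℝ), b τ ^ 2 * ENNReal.ofReal τ) ^ (1 / 2 : ℝ) := by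
        rw [lpNorm]
        congr 1
        simp_rw [hedge, hb2, ENNReal.tsum_mul_left, ← ENNReal.tsum_mul_right]
        rw [lintegral_tsum]
        exact fun e => ((hanti e).measurable.mul ENNReal.measurable_ofReal).aemeasurable
    _ ≤ ((∫⁻ τ in Ioi (0 : ℝ), b τ) ^ 2) ^ (1 / 2 : ℝ) :=
        ENNReal.rpow_le_rpow (lintegral_mul_sq_le_sq_lintegral hbanti) (by norm_num)
    _ = ∫⁻ τ in Ioi (0 : ℝ), b τ := by
        rw [← ENNReal.rpow_natCast, ← ENNReal.rpow_mul]
        norm_num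
    _ ≤ _ := lintegral_mono fun τ => hle τ

/-- The coarea inequality. -/
theorem IsW11.lintegral_perimeter_le {u : Plane → ℝ} {u' : Edge → ℝ → ℝ} (hu : G.IsW11 u u') :
    ∫⁻ τ in Ioi (0 : ℝ), G.perimeter {x ∈ G.carrier | τ < |u x|} ≤ G.lpNorm 1 u' := by
  have hc : ∀ e : G.edges, ContinuousOn (onEdges (fun x => |u x|) e) (Icc 0 1) := fun e =>
    continuousOn_onEdges hu.continuousOn.abs e.2
  calc ∫⁻ τ in Ioi (0 : ℝ), G.perimeter {x ∈ G.carrier | τ < |u x|}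
      ≤ ∫⁻ τ, ∑' e : G.edges, solutionCount (onEdges (fun x => |u x|) e) τ :=
        (setLIntegral_le_lintegral _ _).trans <| lintegral_mono fun τ =>
          (perimeter_superlevel_le hu.continuousOn.abs τ).trans
            (ENNReal.tsum_le_tsum fun e => encard_le_solutionCount _ _)
    _ = ∑' e : G.edges, ∫⁻ τ, solutionCount (onEdges (fun x => |u x|) e) τ :=
        lintegral_tsum fun e => (measurable_solutionCount (hc e)).aemeasurable
    _ ≤ G.lpNorm 1 u' := by
        rw [lpNorm_one]
        refine ENNReal.tsum_le_tsum fun e => ?_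
        rw [setLIntegral_congr (Ioo_ae_eq_Icc (α := ℝ) (μ := volume))]
        refine lintegral_solutionCount_le (hc e) fun s hs t ht hst => ?_
        refine le_trans ?_ (hu.edist_le e.2 s hs t ht hst)
        rw [edist_dist, edist_dist]
        exact ENNReal.ofReal_le_ofReal (abs_abs_sub_abs_le_abs_sub _ _)

/-- An isoperimetric inequality implies the corresponding Sobolev inequality. -/
theorem sobolev_of_isoperimetric
    (hG : ∀ v : Vertex, v ∉ G.verts ↔ ∀ e : Edge, e.Incident v → e ∉ G.edges) {C : ℝ≥0}
    (hC : ∀ Ω : Set Plane, Ω ⊆ G.carrier → Bornology.IsBounded Ω →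
      G.area Ω ^ (1 / 2 : ℝ) ≤ C * G.perimeter Ω)
    {u : Plane → ℝ} {u' : Edge → ℝ → ℝ} (hu : G.IsW11 u u') :
    G.lpNorm 2 (onEdges u) ≤ C * G.lpNorm 1 u' :=
  calc G.lpNorm 2 (onEdges u)
      ≤ ∫⁻ τ in Ioi (0 : ℝ), G.area {x ∈ G.carrier | τ < |u x|} ^ (1 / 2 : ℝ) :=
        lpNorm_two_le hu.continuousOn
    _ ≤ ∫⁻ τ in Ioi (0 : ℝ), C * G.perimeter {x ∈ G.carrier | τ < |u x|} :=
        setLIntegral_mono' measurableSet_Ioi fun _ hτ =>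
          hC _ (sep_subset _ _) (hu.isBounded_superlevel hG hτ)
    _ = C * ∫⁻ τ in Ioi (0 : ℝ), G.perimeter {x ∈ G.carrier | τ < |u x|} :=
        lintegral_const_mul' _ _ ENNReal.coe_ne_top
    _ ≤ C * G.lpNorm 1 u' := by
        gcongr
        exact hu.lintegral_perimeter_le

end Subgrid

/-! ### Lipschitz functions on an edge, and edges near a point -/

theorem hasWeakDeriv_deriv_of_lipschitzOnWith {f : ℝ → ℝ} {K : ℝ≥0}
    (hf : LipschitzOnWith K f (Icc 0 1)) : HasWeakDeriv f (deriv f) := by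
  have hac : AbsolutelyContinuousOnInterval f 0 1 :=
    LipschitzOnWith.absolutelyContinuousOnInterval (by rwa [uIcc_of_le zero_le_one])
  refine ⟨hf.continuousOn.integrableOn_Icc.mono_set Ioo_subset_Icc_self, ?_, fun φ h1 h2 h3 => ?_⟩
  · exact (intervalIntegrable_iff_integrableOn_Ioo_of_le zero_le_one).1 hac.intervalIntegrable_deriv
  · have hφ0 : ∀ x, x ∉ Ioo (0 : ℝ) 1 → φ x = 0 := fun x hx =>
      image_eq_zero_of_notMem_tsupport fun h => hx (h3 h)
    have hφac : AbsolutelyContinuousOnInterval φ 0 1 :=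
      (h1.of_le (by simp)).contDiffOn.absolutelyContinuousOnInterval
    have hparts := hac.integral_mul_deriv_eq_deriv_mul hφac
    rwa [hφ0 1 (by simp), hφ0 0 (by simp), mul_zero, mul_zero, sub_zero, zero_sub,
      intervalIntegral.integral_of_le zero_le_one,
      intervalIntegral.integral_of_le zero_le_one, integral_Ioc_eq_integral_Ioo,
      integral_Ioc_eq_integral_Ioo] at hparts

namespace Edge

/-- The edge with a given direction and a given source. -/
def ofSource (p : Bool × ℤ × ℤ) : Edge := if p.1 then horiz p.2.1 p.2.2 else vert p.2.1 p.2.2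

theorem ofSource_injective : Function.Injective ofSource := by
  rintro ⟨_ | _, i, j⟩ ⟨_ | _, k, l⟩ h <;> simp_all [ofSource]

/-- A finite set of edges containing all those at a distance at most `n` from `x`. -/
noncomputable def near (x : Plane) (n : ℕ) : Finset Edge :=
  (Finset.univ ×ˢ Finset.Icc (⌊x 0⌋ - n - 1) (⌊x 0⌋ + n) ×ˢ
    Finset.Icc (⌊x 1⌋ - n - 1) (⌊x 1⌋ + n)).map ⟨ofSource, ofSource_injective⟩

theorem card_near (x : Plane) (n : ℕ) : (near x n).card = 2 * ((2 * n + 2) * (2 * n + 2)) := by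
  have h : ∀ a : ℤ, (a + n + 1 - (a - n - 1)).toNat = 2 * n + 2 := fun a => by omega
  simp [near, h]

theorem mem_near {e : Edge} {x : Plane} {n : ℕ} {t : ℝ} (ht : t ∈ Icc (0 : ℝ) 1)
    (h : dist (e.point t) x ≤ n) : e ∈ near x n := by
  have hcoord : ∀ i, |e.point t i - x i| ≤ n := fun i =>
    ((PiLp.norm_apply_le (e.point t - x) i).trans_eq (dist_eq_norm _ _).symm).trans h
  -- Used with `s = t` for the coordinate running along the edge and with `s = 0` for the constant
  -- one.
  have key : ∀ (i : ℤ) (a s : ℝ), s ∈ Icc (0 : ℝ) 1 → |i + s - a| ≤ n →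
      i ∈ Finset.Icc (⌊a⌋ - n - 1) (⌊a⌋ + n) := by
    intro i a s hs hi
    rw [abs_le] at hi
    rw [Finset.mem_Icc]
    have h1 := Int.floor_le a
    have h2 := Int.lt_floor_add_one a
    constructor
    · have : ((⌊a⌋ - n - 1 : ℤ) : ℝ) ≤ i := by
        push_cast
        linarith [hs.1, hs.2]
      exact_mod_cast this
    · have : (i : ℝ) < ((⌊a⌋ + n + 1 : ℤ) : ℝ) := by
        push_cast
        linarith [hs.1, hs.2]
      have : i < ⌊a⌋ + n + 1 := by exact_mod_cast this
      omega
  have h0 := hcoord 0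
  have h1 := hcoord 1
  rw [near, Finset.mem_map]
  cases e with
  | horiz i j =>
    simp only [point, PiLp.toLp_apply, Matrix.cons_val_zero, Matrix.cons_val_one] at h0 h1
    refine ⟨(true, i, j), ?_, rfl⟩
    simp only [Finset.mem_product, Finset.mem_univ, true_and]
    exact ⟨key i _ t ht h0, key j _ 0 (by simp) (by simpa using h1)⟩
  | vert i j =>
    simp only [point, PiLp.toLp_apply, Matrix.cons_val_zero, Matrix.cons_val_one] at h0 h1
    refine ⟨(false, i, j), ?_, rfl⟩
    simp only [Finset.mem_product, Finset.mem_univ, true_and]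
    exact ⟨key i _ 0 (by simp) (by simpa using h0), key j _ t ht h1⟩

theorem locallyFinite_carrier : LocallyFinite carrier := by
  intro x
  refine ⟨Metric.closedBall x 1, Metric.closedBall_mem_nhds x one_pos,
    (near x 1).finite_toSet.subset ?_⟩
  rintro e ⟨_, ⟨t, ht, rfl⟩, hx⟩
  exact mem_near ht (by simpa using hx)

/-- The total length of the part of the grid at a distance at most `ε ≤ 1` from a point. -/
theorem tsum_volume_near_le (x : Plane) {ε : ℝ} (hε : ε ≤ 1) :
    ∑' e : Edge, volume {t ∈ Ioo (0 : ℝ) 1 | dist (e.point t) x ≤ ε} ≤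
      64 * ENNReal.ofReal ε := by
  have hvol : ∀ e : Edge, volume {t ∈ Ioo (0 : ℝ) 1 | dist (e.point t) x ≤ ε} ≤
      2 * ENNReal.ofReal ε := by
    intro e
    refine (Real.volume_le_diam _).trans (Metric.ediam_le fun s hs t ht => ?_)
    rw [← e.isometry_point.edist_eq s t]
    refine (edist_triangle_right _ _ x).trans ?_
    rw [two_mul, edist_dist, edist_dist]
    exact add_le_add (ENNReal.ofReal_le_ofReal hs.2) (ENNReal.ofReal_le_ofReal ht.2)
  rw [tsum_eq_sum (s := near x 1)]
  -- The constant 64 is `2 * 32`: there are 32 edges in `near x 1`, and each contributes at most `2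
  -- ε`.
  · refine (Finset.sum_le_card_nsmul _ _ _ fun e _ => hvol e).trans_eq ?_
    rw [card_near, nsmul_eq_mul, ← mul_assoc]
    norm_num
  · intro e he
    convert measure_empty (μ := volume)
    refine eq_empty_of_forall_notMem fun t ht => he ?_
    exact mem_near (Ioo_subset_Icc_self ht.1) (by simpa using ht.2.trans hε)

end Edge

/-! ### Gauges and cutoff functions -/

/-- A function that vanishes exactly on `B` and that coincides near `B` with the distance
to `B`. -/
structure IsGauge (B : Set Plane) (d : Plane → ℝ) : Prop where
  lipschitz : LipschitzWith 1 d
  eq_zero : ∀ x ∈ B, d x = 0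
  pos : ∀ x ∉ B, 0 < d x
  exists_dist_eq : ∀ x, d x < 1 → ∃ b ∈ B, dist x b = d x

/-- The distance to `B` works unless `B` is empty, when `Metric.infDist` is `0` and not positive;
the constant `1` then serves, `exists_dist_eq` being vacuous. -/
theorem exists_isGauge {B : Set Plane} (hB : IsCompact B) : ∃ d, IsGauge B d := by
  rcases B.eq_empty_or_nonempty with rfl | hne
  · exact ⟨fun _ => 1, LipschitzWith.const' 1, by simp, by simp, by simp⟩
  · refine ⟨fun x => Metric.infDist x B, Metric.lipschitz_infDist_pt B,
      fun x hx => Metric.infDist_zero_of_mem hx,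
      fun x hx => (hB.isClosed.notMem_iff_infDist_pos hne).1 hx, fun x _ => ?_⟩
    obtain ⟨b, hb, h⟩ := hB.exists_infDist_eq_dist hne x
    exact ⟨b, hb, h.symm⟩

theorem IsGauge.nonneg {B : Set Plane} {d : Plane → ℝ} (hd : IsGauge B d) (x : Plane) :
    0 ≤ d x := by
  by_cases hx : x ∈ B
  · exact (hd.eq_zero x hx).ge
  · exact (hd.pos x hx).le

/-- The product of the indicator function of `Ω` and of the truncation of `n d` at level `1`. -/
noncomputable def cutoff (Ω : Set Plane) (d : Plane → ℝ) (n : ℕ) : Plane → ℝ :=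
  Ω.indicator fun x => min 1 (n * d x)

theorem norm_cutoff_le {B : Set Plane} {d : Plane → ℝ} (hd : IsGauge B d) (Ω : Set Plane) (n : ℕ)
    (x : Plane) : ‖cutoff Ω d n x‖ ≤ min 1 (n * d x) := by
  have h : 0 ≤ min 1 (n * d x) := le_min zero_le_one (mul_nonneg n.cast_nonneg (hd.nonneg x))
  refine (norm_indicator_le_norm_self _ _).trans_eq ?_
  rw [Real.norm_eq_abs, abs_of_nonneg h]

namespace Subgrid

variable {G : Subgrid}

/-- If no edge through `x` met `G \ Ω`, then `G \ Ω` would lie in the union of the edges avoiding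
`x`. By local finiteness this union is closed, so `x` would not be in the closure of `G \ Ω`. -/
theorem one_le_edgeCount
    (hG : ∀ v : Vertex, v ∉ G.verts ↔ ∀ e : Edge, e.Incident v → e ∉ G.edges)
    {Ω : Set Plane} {x : Plane} (hx : x ∈ G.boundary Ω) : 1 ≤ G.edgeCount Ω x := by
  rw [edgeCount, one_le_encard_iff_nonempty]
  by_contra hempty
  rw [not_nonempty_iff_eq_empty] at hempty
  have hclosed : IsClosed (⋃ e : {e : Edge | x ∉ e.carrier}, (e : Edge).carrier) :=
    (Edge.locallyFinite_carrier.comp_injective Subtype.val_injective).isClosed_iUnion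
      fun e => (e : Edge).isCompact_carrier.isClosed
  have hsub : G.carrier \ Ω ⊆ ⋃ e : {e : Edge | x ∉ e.carrier}, (e : Edge).carrier := by
    intro y hy
    obtain ⟨e, he, hye⟩ := exists_edge_of_mem_carrier hG hy.1
    refine mem_iUnion.2 ⟨⟨e, fun hxe => ?_⟩, hye⟩
    exact (hempty.subset ⟨he, hxe, y, hye, hy⟩ : e ∈ (∅ : Set Edge))
  obtain ⟨e, he⟩ := mem_iUnion.1 (closure_minimal hsub hclosed hx.2.2)
  exact e.2 he

theorem encard_boundary_le_perimeter
    (hG : ∀ v : Vertex, v ∉ G.verts ↔ ∀ e : Edge, e.Incident v → e ∉ G.edges)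
    (Ω : Set Plane) : (((G.boundary Ω).encard : ℕ∞) : ℝ≥0∞) ≤ G.perimeter Ω := by
  rw [← ENNReal.tsum_set_one]
  refine ENNReal.tsum_le_tsum fun x => ?_
  have := ENat.toENNReal_mono (one_le_edgeCount hG x.2)
  rwa [ENat.toENNReal_one] at this

/-- A path along an edge that leaves `Ω` crosses the boundary of `Ω`. -/
theorem exists_point_mem_boundary {Ω : Set Plane} {e : Edge} (he : e ∈ G.edges) {s t : ℝ}
    (hs : s ∈ Icc (0 : ℝ) 1) (ht : t ∈ Icc (0 : ℝ) 1) (hsΩ : e.point s ∈ Ω)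
    (htΩ : e.point t ∉ Ω) : ∃ r ∈ uIcc s t, e.point r ∈ G.boundary Ω := by
  have hsub : uIcc s t ⊆ Icc 0 1 := uIcc_subset_Icc hs ht
  -- Projecting to the segment gives a path defined on all of `ℝ`, where a nonempty proper subset
  -- has a frontier point by connectedness.
  set c : ℝ → uIcc s t := projIcc (min s t) (max s t) min_le_max with hc
  have hcont : Continuous fun r => e.point (c r) :=
    e.continuous_point.comp (continuous_subtype_val.comp continuous_projIcc)
  have heq : ∀ r ∈ uIcc s t, (c r : ℝ) = r := fun r hr => by
    rw [hc, projIcc_of_mem _ hr]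
  have hmem : ∀ r, e.point (c r) ∈ G.carrier := fun r => point_mem_carrier he (hsub (c r).2)
  obtain ⟨r, hr⟩ : (frontier ((fun r => e.point (c r)) ⁻¹' Ω)).Nonempty := by
    refine nonempty_frontier_iff.2 ⟨⟨s, ?_⟩, fun h => htΩ ?_⟩
    · rwa [mem_preimage, heq s left_mem_uIcc]
    · have := h.ge (mem_univ t)
      rwa [mem_preimage, heq t right_mem_uIcc] at this
  rw [frontier_eq_closure_inter_closure] at hr
  exact ⟨c r, (c r).2, hmem r,
    map_mem_closure (f := fun r => e.point (c r)) hcont hr.1 fun y hy => hy,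
    map_mem_closure (f := fun r => e.point (c r)) hcont hr.2 fun y hy => ⟨hmem y, hy⟩⟩

section Cutoff

variable {Ω : Set Plane} {d : Plane → ℝ}

/-- The jump of the indicator does no harm: between a point in `Ω` and one outside there is a
boundary point, at which `d` vanishes. -/
theorem lipschitzOnWith_onEdges_cutoff (hd : IsGauge (G.boundary Ω) d) (n : ℕ) {e : Edge}
    (he : e ∈ G.edges) : LipschitzOnWith n (onEdges (cutoff Ω d n) e) (Icc 0 1) := by
  have hdist : ∀ s t, |d (e.point s) - d (e.point t)| ≤ |s - t| := fun s t => by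
    have := hd.lipschitz.dist_le_mul (e.point s) (e.point t)
    rwa [e.isometry_point.dist_eq, NNReal.coe_one, one_mul, Real.dist_eq, Real.dist_eq] at this
  have key : ∀ s ∈ Icc (0 : ℝ) 1, ∀ t ∈ Icc (0 : ℝ) 1, e.point s ∈ Ω → e.point t ∉ Ω →
      |cutoff Ω d n (e.point s) - cutoff Ω d n (e.point t)| ≤ n * |s - t| := by
    intro s hs t ht hsΩ htΩ
    obtain ⟨r, hr, hrB⟩ := exists_point_mem_boundary he hs ht hsΩ htΩ
    have h1 : cutoff Ω d n (e.point t) = 0 := indicator_of_notMem htΩ _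
    rw [h1, sub_zero]
    refine (norm_cutoff_le hd Ω n _).trans ((min_le_right _ _).trans ?_)
    gcongr
    have h2 := hdist s r
    rw [hd.eq_zero _ hrB, sub_zero] at h2
    refine (le_abs_self _).trans (h2.trans ?_)
    exact abs_sub_comm r s ▸ abs_sub_comm t s ▸ abs_sub_left_of_mem_uIcc hr
  refine LipschitzOnWith.of_dist_le_mul fun s hs t ht => ?_
  simp only [Real.dist_eq, onEdges, NNReal.coe_natCast]
  by_cases hsΩ : e.point s ∈ Ω <;> by_cases htΩ : e.point t ∈ Ω
  · simp only [cutoff, indicator_of_mem hsΩ, indicator_of_mem htΩ]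
    refine (abs_min_sub_min_le_max _ _ _ _).trans ?_
    rw [sub_self, abs_zero, max_eq_right (abs_nonneg _), ← mul_sub, abs_mul, Nat.abs_cast]
    exact mul_le_mul_of_nonneg_left (hdist s t) n.cast_nonneg
  · exact key s hs t ht hsΩ htΩ
  · rw [abs_sub_comm, abs_sub_comm s]
    exact key t ht s hs htΩ hsΩ
  · simp only [cutoff, indicator_of_notMem hsΩ, indicator_of_notMem htΩ, sub_self, abs_zero]
    positivity

/-- Near such a `t` the truncation equals `1` and the edge does not cross the boundary, so the
cutoff is locally constant, `0` or `1`. -/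
theorem deriv_onEdges_cutoff_eq_zero (hd : IsGauge (G.boundary Ω) d) (n : ℕ) {e : Edge}
    (he : e ∈ G.edges) {t : ℝ} (ht : t ∈ Ioo (0 : ℝ) 1) (hdt : 1 < n * d (e.point t)) :
    deriv (onEdges (cutoff Ω d n) e) t = 0 := by
  have hcont : Continuous fun s => n * d (e.point s) :=
    continuous_const.mul (hd.lipschitz.continuous.comp e.continuous_point)
  have hopen : IsOpen (Ioo (0 : ℝ) 1 ∩ {s | 1 < n * d (e.point s)}) :=
    isOpen_Ioo.inter (isOpen_lt continuous_const hcont)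
  obtain ⟨δ, hδ, hball⟩ := Metric.isOpen_iff.1 hopen t ⟨ht, hdt⟩
  have hev : onEdges (cutoff Ω d n) e =ᶠ[𝓝 t] fun _ => onEdges (cutoff Ω d n) e t := by
    filter_upwards [Metric.ball_mem_nhds t hδ] with s hs
    have hnot : ∀ r ∈ uIcc s t, e.point r ∉ G.boundary Ω := fun r hr hrB => by
      have : r ∈ Metric.ball t δ := by
        rw [Real.ball_eq_Ioo] at hs ⊢
        exact ordConnected_Ioo.uIcc_subset hs ⟨by linarith, by linarith⟩ hr
      have h1 : 1 < n * d (e.point r) := (hball this).2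
      rw [hd.eq_zero _ hrB, mul_zero] at h1
      linarith
    have hs' := Ioo_subset_Icc_self (hball hs).1
    have ht' := Ioo_subset_Icc_self ht
    have hiff : e.point s ∈ Ω ↔ e.point t ∈ Ω := by
      constructor
      · intro h
        by_contra h'
        obtain ⟨r, hr, hrB⟩ := exists_point_mem_boundary he hs' ht' h h'
        exact hnot r hr hrB
      · intro h
        by_contra h'
        obtain ⟨r, hr, hrB⟩ := exists_point_mem_boundary he ht' hs' h h'
        exact hnot r (uIcc_comm t s ▸ hr) hrB
    have hds : 1 < n * d (e.point s) := (hball hs).2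
    by_cases h : e.point t ∈ Ω
    · simp only [onEdges, cutoff, indicator_of_mem h, indicator_of_mem (hiff.2 h),
        min_eq_left hdt.le, min_eq_left hds.le]
    · simp only [onEdges, cutoff, indicator_of_notMem h, indicator_of_notMem (mt hiff.1 h)]
  rw [hev.deriv_eq, deriv_const]

theorem lintegral_deriv_cutoff_le (hd : IsGauge (G.boundary Ω) d) {n : ℕ} (hn : 2 ≤ n) {e : Edge}
    (he : e ∈ G.edges) :
    ∫⁻ t in Ioo (0 : ℝ) 1, ‖deriv (onEdges (cutoff Ω d n) e) t‖ₑ ≤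
      n * volume {t ∈ Ioo (0 : ℝ) 1 | ∃ b ∈ G.boundary Ω, dist (e.point t) b ≤ 1 / n} := by
  have hn0 : (0 : ℝ) < n := by positivity
  have hn2 : (2 : ℝ) ≤ n := by exact_mod_cast hn
  calc ∫⁻ t in Ioo (0 : ℝ) 1, ‖deriv (onEdges (cutoff Ω d n) e) t‖ₑ
      ≤ ∫⁻ t in Ioo (0 : ℝ) 1,
          {t ∈ Ioo (0 : ℝ) 1 | ∃ b ∈ G.boundary Ω, dist (e.point t) b ≤ 1 / n}.indicator
            (fun _ => (n : ℝ≥0∞)) t := by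
        refine setLIntegral_mono' measurableSet_Ioo fun t ht => ?_
        by_cases hdt : 1 < n * d (e.point t)
        · rw [deriv_onEdges_cutoff_eq_zero hd n he ht hdt, enorm_zero]
          exact zero_le
        · have h1 : d (e.point t) ≤ 1 / n := by
            rw [le_div_iff₀ hn0, mul_comm]
            exact not_lt.1 hdt
          -- Here `2 ≤ n` is needed: `exists_dist_eq` requires a strict bound.
          have h2 : (1 : ℝ) / n < 1 := by
            rw [div_lt_one hn0]
            linarith
          obtain ⟨b, hb, hbd⟩ := hd.exists_dist_eq _ (h1.trans_lt h2)
          have hmem : t ∈ {t ∈ Ioo (0 : ℝ) 1 | ∃ b ∈ G.boundary Ω, dist (e.point t) b ≤ 1 / n} :=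
            ⟨ht, b, hb, hbd.trans_le h1⟩
          rw [indicator_of_mem hmem]
          have := norm_deriv_le_of_lipschitzOn (Icc_mem_nhds ht.1 ht.2)
            (lipschitzOnWith_onEdges_cutoff hd n he)
          rw [← ofReal_norm]
          refine (ENNReal.ofReal_le_ofReal this).trans_eq ?_
          simp
    _ ≤ ∫⁻ t, {t ∈ Ioo (0 : ℝ) 1 | ∃ b ∈ G.boundary Ω, dist (e.point t) b ≤ 1 / n}.indicator
          (fun _ => (n : ℝ≥0∞)) t := setLIntegral_le_lintegral _ _
    _ ≤ _ := lintegral_indicator_const_le _ _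

theorem lpNorm_deriv_cutoff_le
    (hG : ∀ v : Vertex, v ∉ G.verts ↔ ∀ e : Edge, e.Incident v → e ∉ G.edges)
    (hB : (G.boundary Ω).Finite) (hd : IsGauge (G.boundary Ω) d) {n : ℕ} (hn : 2 ≤ n) :
    G.lpNorm 1 (fun e => deriv (onEdges (cutoff Ω d n) e)) ≤ 64 * G.perimeter Ω := by
  have : Countable (G.boundary Ω) := hB.countable.to_subtype
  have hn1 : (1 : ℝ) ≤ n := by exact_mod_cast one_le_two.trans hn
  have hmul : (n : ℝ≥0∞) * ENNReal.ofReal (1 / n) = 1 := by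
    rw [← ENNReal.ofReal_natCast, ← ENNReal.ofReal_mul n.cast_nonneg,
      mul_one_div_cancel (by positivity), ENNReal.ofReal_one]
  rw [lpNorm_one]
  calc ∑' e : G.edges, ∫⁻ t in Ioo (0 : ℝ) 1, ‖deriv (onEdges (cutoff Ω d n) e) t‖ₑ
      ≤ ∑' e : G.edges, n * ∑' b : G.boundary Ω,
          volume {t ∈ Ioo (0 : ℝ) 1 | dist ((e : Edge).point t) b ≤ 1 / n} := by
        refine ENNReal.tsum_le_tsum fun e => (lintegral_deriv_cutoff_le hd hn e.2).trans ?_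
        gcongr
        refine (measure_mono ?_).trans (measure_iUnion_le _)
        rintro t ⟨ht, b, hb, h⟩
        exact mem_iUnion.2 ⟨⟨b, hb⟩, ht, h⟩
    _ = n * ∑' b : G.boundary Ω, ∑' e : G.edges,
          volume {t ∈ Ioo (0 : ℝ) 1 | dist ((e : Edge).point t) b ≤ 1 / n} := by
        rw [ENNReal.tsum_mul_left, ENNReal.tsum_comm]
    _ ≤ n * ∑' b : G.boundary Ω, 64 * ENNReal.ofReal (1 / n) := by
        gcongr with b
        refine le_trans ?_ (Edge.tsum_volume_near_le b ((div_le_one (by positivity)).2 hn1))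
        exact ENNReal.tsum_comp_le_tsum_of_injective Subtype.val_injective
          fun e : Edge => volume {t ∈ Ioo (0 : ℝ) 1 | dist (e.point t) b ≤ 1 / n}
    _ = 64 * (((G.boundary Ω).encard : ℕ∞) : ℝ≥0∞) := by
        rw [← ENNReal.tsum_set_one, ← ENNReal.tsum_mul_left, ← ENNReal.tsum_mul_left]
        congr 1
        ext b
        rw [mul_left_comm, hmul]
    _ ≤ 64 * G.perimeter Ω := by
        gcongr
        exact encard_boundary_le_perimeter hG Ω

/-- At a boundary point the cutoff is squeezed by `n d`, which vanishes there; any other point of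
`G` has a neighbourhood whose trace on `G` is disjoint from `Ω` or contained in it. -/
theorem continuousOn_cutoff (hd : IsGauge (G.boundary Ω) d) (n : ℕ) :
    ContinuousOn (cutoff Ω d n) G.carrier := by
  have hc : Continuous fun x => min 1 (n * d x) :=
    continuous_const.min (continuous_const.mul hd.lipschitz.continuous)
  intro x hx
  by_cases hxB : x ∈ G.boundary Ω
  · have h0 : min 1 (n * d x) = 0 := by simp [hd.eq_zero x hxB]
    have hx0 : cutoff Ω d n x = 0 :=
      norm_le_zero_iff.1 ((norm_cutoff_le hd Ω n x).trans_eq h0)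
    rw [ContinuousWithinAt, hx0]
    refine squeeze_zero_norm (norm_cutoff_le hd Ω n) ?_
    have := (hc.tendsto x).mono_left (nhdsWithin_le_nhds (s := G.carrier))
    rwa [h0] at this
  · have hor : x ∉ closure Ω ∨ x ∉ closure (G.carrier \ Ω) := by
      by_contra! h
      exact hxB ⟨hx, h⟩
    rcases hor with h | h
    · have hev : cutoff Ω d n =ᶠ[𝓝 x] fun _ => 0 := by
        filter_upwards [isClosed_closure.isOpen_compl.mem_nhds h] with y hy
        exact indicator_of_notMem (fun hyΩ => hy (subset_closure hyΩ)) _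
      exact (continuousAt_const.congr hev.symm).continuousWithinAt
    · have hev : ∀ y ∈ G.carrier, y ∈ (closure (G.carrier \ Ω))ᶜ →
          cutoff Ω d n y = min 1 (n * d y) := fun y hyG hy => by
        refine indicator_of_mem ?_ _
        by_contra hyΩ
        exact hy (subset_closure ⟨hyG, hyΩ⟩)
      have hnhds := isClosed_closure.isOpen_compl.mem_nhds h
      refine hc.continuousWithinAt.congr_of_eventuallyEq ?_ (hev x hx h)
      filter_upwards [self_mem_nhdsWithin, mem_nhdsWithin_of_mem_nhds hnhds] with y hy hy'
      exact hev y hy hy'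

/-- A bounded set meets finitely many edges, and the cutoff is at most `1` on each. -/
theorem lpNorm_cutoff_lt_top (hΩ : Bornology.IsBounded Ω) {B : Set Plane} (hd : IsGauge B d)
    (n : ℕ) : G.lpNorm 1 (onEdges (cutoff Ω d n)) < ⊤ := by
  obtain ⟨R, hR⟩ := hΩ.subset_closedBall 0
  obtain ⟨N, hN⟩ := exists_nat_ge R
  rw [lpNorm_one]
  calc ∑' e : G.edges, ∫⁻ t in Ioo (0 : ℝ) 1, ‖onEdges (cutoff Ω d n) e t‖ₑ
      ≤ ∑' e : Edge, ∫⁻ t in Ioo (0 : ℝ) 1, ‖onEdges (cutoff Ω d n) e t‖ₑ :=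
        ENNReal.tsum_comp_le_tsum_of_injective Subtype.val_injective
          fun e : Edge => ∫⁻ t in Ioo (0 : ℝ) 1, ‖onEdges (cutoff Ω d n) e t‖ₑ
    _ = ∑ e ∈ Edge.near 0 N, ∫⁻ t in Ioo (0 : ℝ) 1, ‖onEdges (cutoff Ω d n) e t‖ₑ := by
        refine tsum_eq_sum fun e he => ?_
        rw [setLIntegral_congr_fun (g := fun _ => 0) measurableSet_Ioo, lintegral_zero]
        intro t ht
        have hnot : e.point t ∉ Ω := fun h =>
          he (Edge.mem_near (Ioo_subset_Icc_self ht) ((hR h).trans hN))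
        simp [onEdges, cutoff, hnot]
    _ ≤ ∑ e ∈ Edge.near 0 N, 1 := by
        refine Finset.sum_le_sum fun e _ => ?_
        calc ∫⁻ t in Ioo (0 : ℝ) 1, ‖onEdges (cutoff Ω d n) e t‖ₑ
            ≤ ∫⁻ _ in Ioo (0 : ℝ) 1, 1 := by
              refine lintegral_mono fun t => ?_
              rw [← ofReal_norm, ← ENNReal.ofReal_one]
              exact ENNReal.ofReal_le_ofReal
                ((norm_cutoff_le hd Ω n _).trans (min_le_left _ _))
          _ = 1 := by simp
    _ < ⊤ := by simp

theorem isW11_cutoff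
    (hG : ∀ v : Vertex, v ∉ G.verts ↔ ∀ e : Edge, e.Incident v → e ∉ G.edges)
    (hΩ : Bornology.IsBounded Ω) (hP : G.perimeter Ω ≠ ⊤) (hB : (G.boundary Ω).Finite)
    (hd : IsGauge (G.boundary Ω) d) {n : ℕ} (hn : 2 ≤ n) :
    G.IsW11 (cutoff Ω d n) (fun e => deriv (onEdges (cutoff Ω d n) e)) where
  continuousOn := continuousOn_cutoff hd n
  hasWeakDeriv _ he := hasWeakDeriv_deriv_of_lipschitzOnWith
    (lipschitzOnWith_onEdges_cutoff hd n he)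
  lpNorm_lt_top := lpNorm_cutoff_lt_top hΩ hd n
  lpNorm_deriv_lt_top := (lpNorm_deriv_cutoff_le hG hB hd hn).trans_lt
    (ENNReal.mul_lt_top (by simp) hP.lt_top)

/-- The area is the supremum of the measures of the sets where the cutoff functions are `1`. -/
theorem area_le_of_forall_cutoff (hB : (G.boundary Ω).Finite) (hd : IsGauge (G.boundary Ω) d)
    {M : ℝ≥0∞} (hM : ∀ n, 2 ≤ n → G.lpNorm 2 (onEdges (cutoff Ω d n)) ≤ M) :
    G.area Ω ≤ M ^ 2 := by
  -- The shift by 2 keeps the index in the range where `hM` applies.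
  set T : G.edges → ℕ → Set ℝ := fun e n =>
    {t ∈ Ioo (0 : ℝ) 1 | 1 ≤ cutoff Ω d (n + 2) ((e : Edge).point t)} with hT
  have hmono : ∀ e, Monotone (T e) := fun e m n hmn t ht => by
    refine ⟨ht.1, ht.2.trans ?_⟩
    refine indicator_le_indicator (min_le_min_left _ ?_)
    have := hd.nonneg ((e : Edge).point t)
    gcongr
  have hsup : ∀ e : G.edges, volume {t ∈ Icc (0 : ℝ) 1 | (e : Edge).point t ∈ Ω} ≤
      ⨆ n, volume (T e n) := by
    intro e
    rw [← (hmono e).measure_iUnion]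
    -- The sets `T e n` miss only the endpoints and the parameters where `d` vanishes, finitely many
    -- in all.
    have hnull : volume ({0, 1} ∪ (e : Edge).point ⁻¹' G.boundary Ω) = 0 :=
      (((Set.toFinite {0, 1}).union
        (hB.preimage (e : Edge).isometry_point.injective.injOn))).measure_zero _
    refine (measure_mono (t := ({0, 1} ∪ (e : Edge).point ⁻¹' G.boundary Ω) ∪ ⋃ n, T e n)
      ?_).trans ((measure_union_le _ _).trans_eq (by rw [hnull, zero_add]))
    rintro t ⟨ht, htΩ⟩
    by_cases h : t ∈ ({0, 1} : Set ℝ) ∪ (e : Edge).point ⁻¹' G.boundary Ω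
    · exact Or.inl h
    · simp only [mem_union, mem_insert_iff, mem_singleton_iff, not_or, mem_preimage] at h
      obtain ⟨N, hN⟩ := exists_nat_gt (1 / d ((e : Edge).point t))
      have hpos := hd.pos _ h.2
      refine Or.inr (mem_iUnion.2 ⟨N, ⟨ht.1.lt_of_ne' h.1.1, ht.2.lt_of_ne h.1.2⟩, ?_⟩)
      rw [cutoff, indicator_of_mem htΩ]
      refine le_min le_rfl ?_
      rw [div_lt_iff₀ hpos] at hN
      push_cast
      nlinarith
  have hle : ∀ n, ∑' e : G.edges, volume (T e n) ≤ M ^ 2 := by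
    intro n
    calc ∑' e : G.edges, volume (T e n)
        ≤ ∑' e : G.edges,
            ∫⁻ t in Ioo (0 : ℝ) 1, ‖onEdges (cutoff Ω d (n + 2)) e t‖ₑ ^ (2 : ℝ) := by
          refine ENNReal.tsum_le_tsum fun e => ?_
          have hm : AEMeasurable (onEdges (cutoff Ω d (n + 2)) e) (volume.restrict (Ioo 0 1)) :=
            ((lipschitzOnWith_onEdges_cutoff hd (n + 2) e.2).continuousOn.mono
              Ioo_subset_Icc_self).aemeasurable measurableSet_Ioo
          have h := mul_meas_ge_le_lintegral₀ (hm.enorm.pow_const (2 : ℝ)) 1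
          rw [one_mul, Measure.restrict_apply' measurableSet_Ioo] at h
          refine le_trans (measure_mono fun t ht => mem_inter ?_ ht.1) h
          refine ENNReal.one_le_rpow ?_ two_pos
          rw [← ofReal_norm, ← ENNReal.ofReal_one]
          exact ENNReal.ofReal_le_ofReal (ht.2.trans (le_abs_self _))
      _ = G.lpNorm 2 (onEdges (cutoff Ω d (n + 2))) ^ 2 := by
          rw [lpNorm, ← ENNReal.rpow_natCast, ← ENNReal.rpow_mul]
          norm_num
      _ ≤ M ^ 2 := by
          gcongr
          exact hM _ (by omega)
  calc G.area Ω ≤ ∑' e : G.edges, ⨆ n, volume (T e n) := ENNReal.tsum_le_tsum hsup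
    _ ≤ M ^ 2 := by
        -- Monotone convergence: on finite sets of edges the sum commutes with the increasing
        -- supremum over `n`.
        rw [ENNReal.tsum_eq_iSup_sum]
        refine iSup_le fun s => ?_
        rw [ENNReal.finsetSum_iSup_of_monotone fun e m n hmn => measure_mono (hmono e hmn)]
        exact iSup_le fun n => (ENNReal.sum_le_tsum s).trans (hle n)

end Cutoff

/-! ### From the Sobolev to the isoperimetric inequality -/

/-- A Sobolev inequality implies an isoperimetric inequality. -/
theorem isoperimetric_of_sobolev
    (hG : ∀ v : Vertex, v ∉ G.verts ↔ ∀ e : Edge, e.Incident v → e ∉ G.edges) {S : ℝ≥0}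
    (hS0 : 0 < S) (hS : ∀ (u : Plane → ℝ) (u' : Edge → ℝ → ℝ), G.IsW11 u u' →
      G.lpNorm 2 (onEdges u) ≤ S * G.lpNorm 1 u')
    {Ω : Set Plane} (hΩ : Bornology.IsBounded Ω) :
    G.area Ω ^ (1 / 2 : ℝ) ≤ (S * 64 : ℝ≥0) * G.perimeter Ω := by
  -- In this case positivity of `S` matters, since `0 * ⊤ = 0`.
  by_cases hP : G.perimeter Ω = ⊤
  · rw [hP, ENNReal.mul_top (by simpa using hS0.ne')]
    exact le_top
  have hB : (G.boundary Ω).Finite := by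
    rw [← encard_lt_top_iff, ← ENat.toENNReal_lt_top]
    exact (encard_boundary_le_perimeter hG Ω).trans_lt (lt_top_iff_ne_top.2 hP)
  obtain ⟨d, hd⟩ := exists_isGauge hB.isCompact
  have hle := area_le_of_forall_cutoff hB hd (M := (S * 64 : ℝ≥0) * G.perimeter Ω) fun n hn => by
    refine (hS _ _ (isW11_cutoff hG hΩ hP hB hd hn)).trans ?_
    rw [ENNReal.coe_mul, mul_assoc]
    gcongr
    exact lpNorm_deriv_cutoff_le hG hB hd hn
  refine (ENNReal.rpow_le_rpow hle (by norm_num)).trans_eq ?_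
  rw [← ENNReal.rpow_natCast, ← ENNReal.rpow_mul]
  norm_num

end Subgrid

end MetricGrid


theorem theorem2p1 (G : MetricGrid.Subgrid) (hG : G.IsDefectedGrid) :
    (∃ S : ℝ≥0, 0 < S ∧ ∀ (u : MetricGrid.Plane → ℝ) (u' : MetricGrid.Edge → ℝ → ℝ),
      G.IsW11 u u' →
        G.lpNorm 2 (MetricGrid.Subgrid.onEdges u) ≤ S * G.lpNorm 1 u') ↔
    (∃ C : ℝ≥0, 0 < C ∧ ∀ Ω : Set MetricGrid.Plane, Ω ⊆ G.carrier → Bornology.IsBounded Ω →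
      G.area Ω ^ (1 / 2 : ℝ) ≤ C * G.perimeter Ω) := by
  constructor
  · rintro ⟨S, hS0, hS⟩
    exact ⟨S * 64, by positivity, fun Ω _ hΩ =>
      MetricGrid.Subgrid.isoperimetric_of_sobolev hG.removed_iff hS0 hS hΩ⟩
  · rintro ⟨C, hC0, hC⟩
    exact ⟨C, hC0, fun u u' hu =>
      MetricGrid.Subgrid.sobolev_of_isoperimetric hG.removed_iff hC hu⟩
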